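/- For $q\ge 1$ let $w_q$ denote the odd wheel $W_{2q+1}$: a hub joined by spikes to all vertices of a rim cycle of length $2q+1$. Sums of wheels below are sums of their edge sets modulo two (an edge is kept iff it lies in an odd number of the wheels), on the union of their vertex sets. A *plane multiwheel* is a sum of a cyclic sequence of $k=2p+1\ge 3$ odd wheels $w_{q_1},\dots,w_{q_k}$ (all $q_i\ge1$) for which there are a vertex $c$ and distinct vertices $v_1,\dots,v_k$ (indices modulo $k$) such that consecutive wheels $w_{q_i},w_{q_{i+1}}$ have in common exactly the edge $cv_{i+1}$ and its ends, non-consecutive wheels have in common exactly the vertex $c$, and, if $c$ is the hub of the $i$-th wheel, then its two annihilated spikes $cv_i,cv_{i+1}$ are sequential (so $v_iv_{i+1}$ is a rim edge of this wheel). A *projective-plane multiwheel* is a sum of a cyclic sequence of $k=2p+1\ge 3$ odd wheels $w_{q_1},\dots,w_{q_k}$ (all $q_i\ge 1$) and of one central wheel $w_p$ with rim $n_1,\dots,n_k$, for which there are distinct vertices $o_1,\dots,o_k$ such that in the $i$-th wheel the path $o_i,n_i,n_{i+1},o_{i+1}$, read in one of its two directions as $a,h,b,d$, consists of two spikes $ha,hb$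 ($h$ the hub) with $ab$ a rim edge, and of a rim edge $bd$ with $d\ne a$; the $i$-th wheel has in common with the central wheel exactly the edge $n_in_{i+1}$ and its ends, and with the $(i+1)$-st wheel exactly the edge $n_{i+1}o_{i+1}$ and its ends; non-consecutive outer wheels are disjoint. The *Grötzsch class* consists of the graphs obtained in this last way with $q_1=\dots=q_k=1$, i.e. of the sums $k\,w_1+w_p$ with $k=2p+1$, $p\ge1$. A graph *quadrangulates the projective plane* if it embeds in the projective plane so that every face is an open disc bounded by a closed walk of length four. **Theorem.** If a multiwheel, plane or projective-plane, quadrangulates the projective plane, then it belongs to the Grötzsch class. -/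

import Mathlib

open scoped Topology

/-! ### Odd wheels and edge sums modulo two -/

/-- A copy, on vertices of `V`, of the odd wheel with `2 * q + 1` spikes: a hub joined to every
vertex of a rim cycle of length `2 * q + 1`.  (It is a genuine wheel when `1 ≤ q`.) -/
structure OddWheel (V : Type*) (q : ℕ) where
  hub : V
  rim : ZMod (2 * q + 1) → V
  rim_injective : Function.Injective rim
  rim_ne_hub : ∀ j, rim j ≠ hub

namespace OddWheel

variable {V : Type*} {q : ℕ}

/-- The vertices of a wheel. -/
def verts (W : OddWheel V q) : Set V := insert W.hub (Set.range W.rim)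

/-- The spikes of a wheel: the edges joining the hub to the rim. -/
def spikes (W : OddWheel V q) : Set (Sym2 V) := Set.range fun j => s(W.hub, W.rim j)

/-- The rim edges of a wheel. -/
def rimEdges (W : OddWheel V q) : Set (Sym2 V) := Set.range fun j => s(W.rim j, W.rim (j + 1))

/-- All edges of a wheel. -/
def edges (W : OddWheel V q) : Set (Sym2 V) := W.spikes ∪ W.rimEdges

end OddWheel

/-- The sum modulo two of a (finite) family of edge sets: an edge survives exactly when it lies in
an odd number of members of the family. -/
def edgeSum {V ι : Type*} (E : ι → Set (Sym2 V)) : Set (Sym2 V) :=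
  {e | Odd {i | e ∈ E i}.ncard}

/-! ### Plane multiwheels -/

/-- `G` is the edge sum modulo two of the odd wheels `w_{q i}`, where `i` runs cyclically over
`2 * p + 1` indices.  All wheels share the vertex `c`; cyclically consecutive wheels overlap exactly
in one edge `c v`, so each wheel loses exactly two edges, both at `c`. -/
def IsPlaneWheelSum {V : Type*} (G : SimpleGraph V) (p : ℕ) (q : ZMod (2 * p + 1) → ℕ) : Prop :=
  ∃ (W : ∀ i, OddWheel V (q i)) (c : V) (v : ZMod (2 * p + 1) → V),
    -- every vertex of `G` belongs to some wheel
    (∀ x, ∃ i, x ∈ (W i).verts) ∧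
    Function.Injective v ∧
    -- the two edges which the `i`-th wheel loses
    (∀ i, s(c, v i) ∈ (W i).edges ∧ s(c, v (i + 1)) ∈ (W i).edges) ∧
    -- consecutive wheels meet in the ends of the common edge, other wheels meet in `c` only
    (∀ i, (W i).verts ∩ (W (i + 1)).verts = {c, v (i + 1)}) ∧
    (∀ i j, i ≠ j → j ≠ i + 1 → i ≠ j + 1 → (W i).verts ∩ (W j).verts = {c}) ∧
    -- planarity of the sections: if two spikes are lost, they are sequential spikes of the wheel
    (∀ i, (W i).hub = c → s(v i, v (i + 1)) ∈ (W i).rimEdges) ∧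
    G.edgeSet = edgeSum fun i => (W i).edges

/-- Plane multiwheels: an odd number, at least three, of arbitrary odd wheels are summed. -/
def IsPlaneMultiwheel {V : Type*} (G : SimpleGraph V) : Prop :=
  ∃ (p : ℕ) (q : ZMod (2 * p + 1) → ℕ), 1 ≤ p ∧ (∀ i, 1 ≤ q i) ∧ IsPlaneWheelSum G p q

/-! ### Projective-plane multiwheels and the Grötzsch class -/

/-- `a`, `h`, `b`, `d` is a path in `W` consisting of two proximal spikes `h a`, `h b` and of the
rim edge `b d`, which does not form a triangle with them; its middle edge is the spike `h b`. -/
def OddWheel.IsLostPath {V : Type*} {q : ℕ} (W : OddWheel V q) (a h b d : V) : Prop :=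
  W.hub = h ∧ s(h, a) ∈ W.spikes ∧ s(h, b) ∈ W.spikes ∧
    s(a, b) ∈ W.rimEdges ∧ s(b, d) ∈ W.rimEdges ∧ a ≠ d

/-- `G` is the edge sum modulo two of the odd wheels `w_{q i}`, where `i` runs cyclically over
`2 * p + 1` indices, and of one central wheel `w_p`.  In each outer wheel a path of two proximal
spikes and a rim edge is lost: its middle spike is matched with a rim edge of the central wheel,
its two other edges are matched with such edges of the two cyclically neighbouring wheels. -/
def IsProjectiveWheelSum {V : Type*} (G : SimpleGraph V) (p : ℕ) (q : ZMod (2 * p + 1) → ℕ) :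
    Prop :=
  ∃ (W : ∀ i, OddWheel V (q i)) (C : OddWheel V p) (o : ZMod (2 * p + 1) → V),
    -- every vertex of `G` belongs to some wheel
    (∀ x, x ∈ C.verts ∨ ∃ i, x ∈ (W i).verts) ∧
    Function.Injective o ∧
    -- the lost path of the `i`-th wheel, traversed in one of the two possible directions
    (∀ i, (W i).IsLostPath (o i) (C.rim i) (C.rim (i + 1)) (o (i + 1)) ∨
      (W i).IsLostPath (o (i + 1)) (C.rim (i + 1)) (C.rim i) (o i)) ∧
    -- wheels meet in the ends of their common edge only
    (∀ i, (W i).verts ∩ C.verts = {C.rim i, C.rim (i + 1)}) ∧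
    (∀ i, (W i).verts ∩ (W (i + 1)).verts = {C.rim (i + 1), o (i + 1)}) ∧
    (∀ i j, i ≠ j → j ≠ i + 1 → i ≠ j + 1 → Disjoint (W i).verts (W j).verts) ∧
    G.edgeSet = edgeSum fun i : Option (ZMod (2 * p + 1)) => i.elim C.edges fun i => (W i).edges

/-- Projective-plane multiwheels: the outer wheels are arbitrary odd wheels. -/
def IsProjectiveMultiwheel {V : Type*} (G : SimpleGraph V) : Prop :=
  ∃ (p : ℕ) (q : ZMod (2 * p + 1) → ℕ), 1 ≤ p ∧ (∀ i, 1 ≤ q i) ∧ IsProjectiveWheelSum G p q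

/-- The Grötzsch class: the sums `k w_1 + w_p` with `k = 2 * p + 1`, `p ≥ 1`.  (These are the graphs
obtained from odd cycles by Mycielski's construction; `p = 2` gives the Grötzsch graph.) -/
def IsGrotzschClass {V : Type*} (G : SimpleGraph V) : Prop :=
  ∃ p : ℕ, 1 ≤ p ∧ IsProjectiveWheelSum G p fun _ => 1

/-! ### Quadrangulations of the projective plane -/

/-- The real projective plane: the unit sphere of `ℝ³` with antipodal points identified. -/
def ProjectivePlane : Type :=
  Quot fun x y : Metric.sphere (0 : EuclideanSpace ℝ (Fin 3)) 1 => y = -x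

instance : TopologicalSpace ProjectivePlane := inferInstanceAs (TopologicalSpace (Quot _))

/-- The corners of the square with vertices `1, I, -1, -I`, in cyclic order. -/
noncomputable def squareCorner (j : ZMod 4) : ℂ := Complex.I ^ j.val

/-- The solid square with vertices `1, I, -1, -I`. -/
def solidSquare : Set ℂ := convexHull ℝ (Set.range squareCorner)

/-- Data for a closed quadrangulated surface with `m` faces in which `G` is the graph of vertices
and edges: `m` squares whose sides are labelled by edges of `G` and glued in pairs.  The boundary of
the face `f` is the closed walk `bd f 0, bd f 1, bd f 2, bd f 3, bd f 0` of `G`. -/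
structure Quadrangulation {V : Type*} (G : SimpleGraph V) (m : ℕ) where
  bd : Fin m → ZMod 4 → V
  adj : ∀ f j, G.Adj (bd f j) (bd f (j + 1))
  /-- every vertex lies on a face -/
  vertex_mem : ∀ v, ∃ f j, bd f j = v
  /-- every edge of `G` is the common edge of exactly two sides of faces -/
  two_sides : ∀ e ∈ G.edgeSet,
    {x : Fin m × ZMod 4 | s(bd x.1 x.2, bd x.1 (x.2 + 1)) = e}.ncard = 2
  /-- the face corners at each vertex form a single cycle around it -/
  link_connected : ∀ v u w, G.Adj v u → G.Adj v w →
    Relation.ReflTransGen (fun x y => ∃ f j, bd f j = v ∧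
      (bd f (j - 1) = x ∧ bd f (j + 1) = y ∨ bd f (j - 1) = y ∧ bd f (j + 1) = x)) u w

namespace Quadrangulation

variable {V : Type*} {G : SimpleGraph V} {m : ℕ}

/-- Points on sides of the squares are glued when the sides carry the same edge of `G` and the
points have the same position along this edge. -/
def Glued (Q : Quadrangulation G m) (x y : Fin m × solidSquare) : Prop :=
  ∃ (j l : ZMod 4) (t : ℝ), 0 ≤ t ∧ t ≤ 1 ∧
    (x.2 : ℂ) = AffineMap.lineMap (squareCorner j) (squareCorner (j + 1)) t ∧
    ((Q.bd x.1 j = Q.bd y.1 l ∧ Q.bd x.1 (j + 1) = Q.bd y.1 (l + 1) ∧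
        (y.2 : ℂ) = AffineMap.lineMap (squareCorner l) (squareCorner (l + 1)) t) ∨
      (Q.bd x.1 j = Q.bd y.1 (l + 1) ∧ Q.bd x.1 (j + 1) = Q.bd y.1 l ∧
        (y.2 : ℂ) = AffineMap.lineMap (squareCorner (l + 1)) (squareCorner l) t))

/-- The surface obtained from `m` disjoint solid squares by gluing their sides. -/
def Surface (Q : Quadrangulation G m) : Type := Quot Q.Glued

instance (Q : Quadrangulation G m) : TopologicalSpace Q.Surface :=
  inferInstanceAs (TopologicalSpace (Quot _))

end Quadrangulation

/-- `G` quadrangulates the projective plane: it embeds there so that every face is an open disc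
bounded by a closed walk of length four, i.e. the projective plane is obtained by gluing squares
along their sides, `G` being the resulting graph of vertices and edges. -/
def QuadrangulatesProjectivePlane {V : Type*} (G : SimpleGraph V) : Prop :=
  ∃ (m : ℕ) (Q : Quadrangulation G m), Nonempty (Q.Surface ≃ₜ ProjectivePlane)

/-! The argument is local. The faces around a vertex of a quadrangulation follow the cyclic order of
its edges, so at a vertex of degree at most three any two neighbours are consecutive. They therefore
lie on a common face, and the opposite corner of that face is a second common neighbour of them
(`exists_common_neighbor`).

A wheel in a multiwheel loses only a few edges, and its vertices that are not shared with other
wheels keep their neighbourhoods (`IsSection`). If it has at least five spikes, some unshared rim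
vertex has degree three and two neighbours with no other common neighbour: the remaining candidates
are too far away along the rim or need a lost edge. So all `q i` equal one. In the projective-plane
case this already gives the Grötzsch class, since the central wheel is `w_p` by definition.

A plane multiwheel is then a sum of copies of the complete graph on four vertices `c`, `v i`, `v (i
+ 1)`, `u i`. The vertex `u i` has degree three, and `v i`, `v (i + 1)` need another common
neighbour. It is not `c`, whose edges to them are lost, so it is shared by the two wheels adjacent
to the `i`-th one; these meet outside `c` only if there are just three wheels. The sum of three such
wheels is finally rewritten as a projective-plane sum with `p = 1`. -/

namespace Quadrangulation

/-! ### Face corners at vertices of small degree -/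

variable {V : Type*} {G : SimpleGraph V} {m : ℕ}

theorem sides_eq_pair (Q : Quadrangulation G m) {e : Sym2 V} (he : e ∈ G.edgeSet)
    {a b : Fin m × ZMod 4} (hab : a ≠ b) (ha : s(Q.bd a.1 a.2, Q.bd a.1 (a.2 + 1)) = e)
    (hb : s(Q.bd b.1 b.2, Q.bd b.1 (b.2 + 1)) = e) {x : Fin m × ZMod 4}
    (hx : s(Q.bd x.1 x.2, Q.bd x.1 (x.2 + 1)) = e) : x = a ∨ x = b := by
  have h2 := Q.two_sides e he
  have hsub : ({a, b} : Set (Fin m × ZMod 4)) ⊆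
      {x | s(Q.bd x.1 x.2, Q.bd x.1 (x.2 + 1)) = e} := by
    rintro y (rfl | rfl)
    · exact ha
    · exact hb
  have heq := Set.eq_of_subset_of_ncard_le hsub (by rw [h2, Set.ncard_pair hab]) (Set.toFinite _)
  have : x ∈ ({a, b} : Set (Fin m × ZMod 4)) := heq ▸ hx
  simpa using this

/-- A face turns back at a vertex only if that vertex has a single neighbour. -/
theorem eq_of_backtrack (Q : Quadrangulation G m) {f : Fin m} {j : ZMod 4}
    (h : Q.bd f (j - 1) = Q.bd f (j + 1)) {u : V} (hu : G.Adj (Q.bd f j) u) :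
    u = Q.bd f (j + 1) := by
  have hadj := Q.adj f j
  have hne := hadj.ne
  have hpair : (f, j) ≠ (f, j - 1) := by
    intro hc
    have : j = j - 1 := congrArg Prod.snd hc
    exact (by decide : (1 : ZMod 4) ≠ 0) (sub_eq_self.1 this.symm)
  -- The two sides carrying the edge traversed back and forth are consecutive sides of `f`, so no
  -- other side carries it.
  have key : ∀ {x : Fin m × ZMod 4},
      s(Q.bd x.1 x.2, Q.bd x.1 (x.2 + 1)) = s(Q.bd f j, Q.bd f (j + 1)) →
        x = (f, j) ∨ x = (f, j - 1) := fun hx =>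
    Q.sides_eq_pair (e := s(Q.bd f j, Q.bd f (j + 1))) hadj hpair rfl
      (by simp only [sub_add_cancel]; rw [h, Sym2.eq_swap]) hx
  -- A walk in the link starting at this neighbour can only use the corner `(f, j)`, whose two ends
  -- coincide; so it never leaves its start.
  have hR := Q.link_connected _ _ _ hadj hu
  induction hR with
  | refl => rfl
  | tail _ hstep ih =>
    rename_i b c _
    obtain ⟨f', j', hv, hcase⟩ := hstep
    have hb : b = Q.bd f (j + 1) := by
      apply ih
      rcases hcase with ⟨h1, -⟩ | ⟨-, h1⟩
      · rw [← h1, ← hv]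
        have := Q.adj f' (j' - 1)
        rw [sub_add_cancel] at this
        exact this.symm
      · rw [← h1, ← hv]
        exact Q.adj f' j'
    rcases hcase with ⟨h1, h2⟩ | ⟨h1, h2⟩
    · rcases key (x := (f', j' - 1)) (by simp only [sub_add_cancel]; rw [h1, hv, hb, Sym2.eq_swap])
        with hx | hx
      · obtain ⟨rfl, hj⟩ := Prod.mk.inj hx
        rw [hj, hb] at h1
        exact absurd h1 hne
      · obtain ⟨rfl, hj⟩ := Prod.mk.inj hx
        obtain rfl : j' = j := sub_left_injective hj
        exact h2.symm
    · rcases key (x := (f', j')) (by simp only; rw [h2, hv, hb]) with hx | hx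
      · obtain ⟨rfl, rfl⟩ := Prod.mk.inj hx
        rw [← h1, h]
      · obtain ⟨rfl, rfl⟩ := Prod.mk.inj hx
        rw [h] at hv
        exact absurd hv.symm hne

/-- The face corners at `v` which have the edge `v x` as a side. -/
def corners (Q : Quadrangulation G m) (v x : V) : Set (Fin m × ZMod 4) :=
  {a | Q.bd a.1 a.2 = v ∧ (Q.bd a.1 (a.2 - 1) = x ∨ Q.bd a.1 (a.2 + 1) = x)}

theorem adj_pred (Q : Quadrangulation G m) (f : Fin m) (j : ZMod 4) :
    G.Adj (Q.bd f j) (Q.bd f (j - 1)) := by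
  have := Q.adj f (j - 1)
  rw [sub_add_cancel] at this
  exact this.symm

/-- Each of the two sides carrying the edge has exactly one end at `v` and so determines a corner.
The same corner could come from both sides only if the face turned back at `v`, which the second
neighbour `u` forbids. -/
theorem ncard_corners (Q : Quadrangulation G m) {v x u : V} (hx : G.Adj v x) (hu : G.Adj v u)
    (hux : u ≠ x) : (Q.corners v x).ncard = 2 := by
  classical
  rw [← Q.two_sides s(v, x) hx]
  refine Set.ncard_congr
    (fun a _ => if Q.bd a.1 (a.2 + 1) = x then a else (a.1, a.2 - 1)) ?_ ?_ ?_
  · rintro ⟨f, j⟩ ⟨h1, h2⟩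
    dsimp only at h1 h2 ⊢
    split_ifs with h
    · simp only [Set.mem_ofPred_eq]
      rw [h1, h]
    · simp only [Set.mem_ofPred_eq, sub_add_cancel]
      rw [h1, h2.resolve_right h, Sym2.eq_swap]
  · rintro ⟨f, j⟩ ⟨f', j'⟩ ⟨h1, h2⟩ ⟨h1', h2'⟩ heq
    dsimp only at h1 h2 h1' h2' heq
    split_ifs at heq with h h' h'
    · exact heq
    · obtain ⟨rfl, rfl⟩ := Prod.mk.inj heq
      rw [sub_add_cancel, h1'] at h
      exact absurd h hx.ne
    · obtain ⟨rfl, rfl⟩ := Prod.mk.inj heq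
      rw [sub_add_cancel, h1] at h'
      exact absurd h' hx.ne
    · obtain ⟨rfl, hj⟩ := Prod.mk.inj heq
      rw [sub_left_injective hj]
  · rintro ⟨f, l⟩ hs
    simp only [Set.mem_ofPred_eq, Sym2.eq_iff] at hs
    rcases hs with ⟨h1, h2⟩ | ⟨h1, h2⟩
    · exact ⟨(f, l), ⟨h1, Or.inr h2⟩, by simp [h2]⟩
    · refine ⟨(f, l + 1), ⟨h2, Or.inl (by simpa using h1)⟩, ?_⟩
      have hne : Q.bd f (l + 1 + 1) ≠ x := by
        intro h3
        have := Q.eq_of_backtrack (f := f) (j := l + 1) (u := u)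
          (by rw [h3, add_sub_cancel_right, h1]) (by rw [h2]; exact hu)
        exact hux (this.trans h3)
      simp [hne]

/-- At a vertex of degree at most three, any two neighbours span a face corner. -/
theorem exists_corner (Q : Quadrangulation G m) {v x y w : V} (hx : G.Adj v x) (hy : G.Adj v y)
    (hxy : x ≠ y) (hN : ∀ u, G.Adj v u → u = x ∨ u = y ∨ u = w) :
    (Q.corners v x ∩ Q.corners v y).Nonempty := by
  by_contra hemp
  rw [Set.not_nonempty_iff_eq_empty, ← Set.disjoint_iff_inter_eq_empty] at hemp
  have cx := Q.ncard_corners hx hy hxy.symm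
  have cy := Q.ncard_corners hy hx hxy
  -- A corner with side `v x` has two different ends; if `y` is excluded, the other end can only be
  -- `w`.
  have other : ∀ {x y : V}, G.Adj v y → x ≠ y → (∀ u, G.Adj v u → u = x ∨ u = y ∨ u = w) →
      Disjoint (Q.corners v x) (Q.corners v y) → Q.corners v x ⊆ Q.corners v w := by
    rintro x y hy hxy hN hd ⟨f, j⟩ ⟨h1, h2⟩
    have hnot : ¬ (Q.bd f (j - 1) = y ∨ Q.bd f (j + 1) = y) := fun h3 =>
      Set.disjoint_left.1 hd (show (f, j) ∈ Q.corners v x from ⟨h1, h2⟩) ⟨h1, h3⟩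
    dsimp only at h1 h2
    refine ⟨h1, ?_⟩
    dsimp only
    have hb : ¬ Q.bd f (j - 1) = Q.bd f (j + 1) := by
      intro hb
      have := Q.eq_of_backtrack hb (u := y) (by rw [h1]; exact hy)
      exact hnot (Or.inr this.symm)
    have hp := hN _ (h1 ▸ Q.adj_pred f j)
    have hn := hN _ (h1 ▸ Q.adj f j)
    grind
  have hxw := other hy hxy hN hemp
  have hyw := other hx hxy.symm (fun u hu => by have := hN u hu; tauto) hemp.symm
  -- So far `w` is only a candidate for a third neighbour, possibly equal to `x` or `y`.
  have hw : G.Adj v w := by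
    obtain ⟨⟨f, j⟩, hf⟩ : (Q.corners v x).Nonempty := by
      rw [← Set.ncard_pos (Set.toFinite _)]; omega
    obtain ⟨h1, h2 | h2⟩ := hxw hf
    · rw [← h1, ← h2]; exact Q.adj_pred f j
    · rw [← h1, ← h2]; exact Q.adj f j
  have cw : (Q.corners v w).ncard = 2 := by
    by_cases hwx : w = x
    · exact Q.ncard_corners hw hy (fun h => hxy (hwx.symm.trans h.symm))
    · exact Q.ncard_corners hw hx (Ne.symm hwx)
  -- Two corners at `v x` and two others at `v y` would all be among the two corners at `v w`.
  have := Set.ncard_le_ncard (Set.union_subset hxw hyw) (Set.toFinite _)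
  rw [Set.ncard_union_eq hemp (Set.toFinite _) (Set.toFinite _)] at this
  omega

/-- At a vertex `v` of degree at most three, any two neighbours `x`, `y` are opposite corners
of a four-cycle through `v`, unless one of them is a leaf. -/
theorem exists_common_neighbor (Q : Quadrangulation G m) {v x y w : V} (hx : G.Adj v x)
    (hy : G.Adj v y) (hxy : x ≠ y) (hN : ∀ u, G.Adj v u → u = x ∨ u = y ∨ u = w)
    {y' : V} (hy' : G.Adj y y') (hne : y' ≠ v) : ∃ z, z ≠ v ∧ G.Adj x z ∧ G.Adj y z := by
  obtain ⟨⟨f, j⟩, ⟨h1, h2⟩, -, h3⟩ := Q.exists_corner hx hy hxy hN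
  dsimp only at h1 h2 h3
  have e1 : j + 1 + 1 = j + 2 := by ring
  have e2 : j - 1 - 1 = j + 2 := (by decide : ∀ j : ZMod 4, j - 1 - 1 = j + 2) j
  have a1 := Q.adj f (j + 1)
  have a2 := Q.adj_pred f (j - 1)
  rw [e1] at a1
  rw [e2] at a2
  have hcase : (Q.bd f (j - 1) = x ∧ Q.bd f (j + 1) = y) ∨
      (Q.bd f (j - 1) = y ∧ Q.bd f (j + 1) = x) := by grind
  refine ⟨Q.bd f (j + 2), ?_, ?_⟩
  -- If the opposite corner were `v`, the face would turn back at `y`, leaving `v` as the only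
  -- neighbour of `y`, contrary to `y'`.
  · intro hz
    rcases hcase with ⟨-, h⟩ | ⟨h, -⟩
    · have := Q.eq_of_backtrack (f := f) (j := j + 1) (u := y')
        (by rw [e1, add_sub_cancel_right, h1, hz]) (h ▸ hy')
      rw [e1, hz] at this
      exact hne this
    · have := Q.eq_of_backtrack (f := f) (j := j - 1) (u := y')
        (by rw [e2, sub_add_cancel, h1, hz]) (h ▸ hy')
      rw [sub_add_cancel, h1] at this
      exact hne this
  · rcases hcase with ⟨h, h'⟩ | ⟨h, h'⟩
    · exact ⟨h ▸ a2, h' ▸ a1⟩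
    · exact ⟨h' ▸ a1, h ▸ a2⟩

end Quadrangulation

/-! ### Odd wheels, their symmetries and their sections -/

theorem ZMod.natCast_ne_zero_of_lt {n k : ℕ} (hk : 0 < k) (hkn : k < n) : (k : ZMod n) ≠ 0 := by
  rw [Ne, ZMod.natCast_eq_zero_iff]
  exact fun h => absurd (Nat.le_of_dvd hk h) (by omega)

namespace OddWheel

variable {V : Type*} {q : ℕ}

theorem hub_mem_verts (W : OddWheel V q) : W.hub ∈ W.verts := Set.mem_insert _ _

theorem rim_mem_verts (W : OddWheel V q) (j : ZMod (2 * q + 1)) : W.rim j ∈ W.verts :=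
  Set.mem_insert_of_mem _ ⟨j, rfl⟩

theorem mem_verts_of_mem_edges (W : OddWheel V q) {x y : V} (h : s(x, y) ∈ W.edges) :
    x ∈ W.verts ∧ y ∈ W.verts := by
  rcases h with ⟨j, hj⟩ | ⟨j, hj⟩ <;> rcases Sym2.eq_iff.1 hj with ⟨rfl, rfl⟩ | ⟨rfl, rfl⟩ <;>
    simp [hub_mem_verts, rim_mem_verts]

theorem spike_mem_edges (W : OddWheel V q) (j : ZMod (2 * q + 1)) :
    s(W.hub, W.rim j) ∈ W.edges := Or.inl ⟨j, rfl⟩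

theorem rim_succ_mem_edges (W : OddWheel V q) (j : ZMod (2 * q + 1)) :
    s(W.rim j, W.rim (j + 1)) ∈ W.edges := Or.inr ⟨j, rfl⟩

theorem rim_rim_mem_edges_iff (W : OddWheel V q) {i j : ZMod (2 * q + 1)} :
    s(W.rim i, W.rim j) ∈ W.edges ↔ j = i + 1 ∨ i = j + 1 := by
  constructor
  · rintro (⟨l, hl⟩ | ⟨l, hl⟩) <;> rcases Sym2.eq_iff.1 hl with ⟨h1, h2⟩ | ⟨h1, h2⟩
    · exact absurd h1.symm (W.rim_ne_hub _)
    · exact absurd h1.symm (W.rim_ne_hub _)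
    · left; rw [← W.rim_injective h1, ← W.rim_injective h2]
    · right; rw [← W.rim_injective h1, ← W.rim_injective h2]
  · rintro (rfl | rfl)
    · exact W.rim_succ_mem_edges i
    · rw [Sym2.eq_swap]; exact W.rim_succ_mem_edges j

theorem ne_of_mem_edges (W : OddWheel V q) (hq : 1 ≤ q) {x y : V} (h : s(x, y) ∈ W.edges) :
    x ≠ y := by
  have h1 := ZMod.natCast_ne_zero_of_lt (n := 2 * q + 1) one_pos (by omega)
  rw [Nat.cast_one] at h1
  rcases h with ⟨j, hj⟩ | ⟨j, hj⟩ <;> rcases Sym2.eq_iff.1 hj with ⟨rfl, rfl⟩ | ⟨rfl, rfl⟩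
  · exact (W.rim_ne_hub _).symm
  · exact W.rim_ne_hub _
  · exact W.rim_injective.ne (by simpa using h1)
  · exact W.rim_injective.ne (by simpa using h1)

theorem mem_rimEdges_of_mem_edges (W : OddWheel V q) {x y : V} (h : s(x, y) ∈ W.edges)
    (hx : x ≠ W.hub) (hy : y ≠ W.hub) : s(x, y) ∈ W.rimEdges := by
  rcases h with ⟨j, hj⟩ | h
  · rcases Sym2.eq_iff.1 hj with ⟨rfl, rfl⟩ | ⟨rfl, rfl⟩ <;> simp at hx hy
  · exact h

/-- The same wheel, with the rim read from another vertex and possibly in the other direction. -/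
def reindex (W : OddWheel V q) (t : ZMod (2 * q + 1)) (ε : ℤˣ) : OddWheel V q where
  hub := W.hub
  rim j := W.rim (t + ((ε : ℤ) : ZMod (2 * q + 1)) * j)
  rim_injective i j h := by
    have := W.rim_injective h
    rcases Int.units_eq_one_or ε with rfl | rfl <;> simpa using this
  rim_ne_hub j := W.rim_ne_hub _

theorem _root_.ZMod.surjective_affine {n : ℕ} (t : ZMod n) (ε : ℤˣ) :
    Function.Surjective fun j : ZMod n => t + ((ε : ℤ) : ZMod n) * j := by
  intro j
  rcases Int.units_eq_one_or ε with rfl | rfl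
  · exact ⟨j - t, by simp⟩
  · exact ⟨t - j, by simp⟩

theorem verts_reindex (W : OddWheel V q) (t : ZMod (2 * q + 1)) (ε : ℤˣ) :
    (W.reindex t ε).verts = W.verts := by
  have : Set.range (W.reindex t ε).rim = Set.range W.rim :=
    (ZMod.surjective_affine t ε).range_comp W.rim
  rw [verts, verts, this]
  rfl

theorem rimEdges_reindex (W : OddWheel V q) (t : ZMod (2 * q + 1)) (ε : ℤˣ) :
    (W.reindex t ε).rimEdges = W.rimEdges := by
  rcases Int.units_eq_one_or ε with rfl | rfl
  · refine Eq.trans ?_ ((ZMod.surjective_affine t 1).range_comp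
      fun j => s(W.rim j, W.rim (j + 1)))
    simp only [rimEdges, reindex]
    congr 1
    funext j
    simp [add_assoc]
  · refine Eq.trans ?_ ((ZMod.surjective_affine (t - 1) (-1)).range_comp
      fun j => s(W.rim j, W.rim (j + 1)))
    simp only [rimEdges, reindex]
    congr 1
    funext j
    have e1 : t + -(j + 1) = t - 1 + -j := by ring
    have e2 : t - 1 + -j + 1 = t + -j := by ring
    simp only [Function.comp, Units.val_neg, Units.val_one, Int.cast_neg, Int.cast_one, neg_mul,
      one_mul, e1, e2]
    exact Sym2.eq_swap

theorem spikes_reindex (W : OddWheel V q) (t : ZMod (2 * q + 1)) (ε : ℤˣ) :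
    (W.reindex t ε).spikes = W.spikes :=
  (ZMod.surjective_affine t ε).range_comp fun j => s(W.hub, W.rim j)

theorem edges_reindex (W : OddWheel V q) (t : ZMod (2 * q + 1)) (ε : ℤˣ) :
    (W.reindex t ε).edges = W.edges := by
  rw [edges, edges, spikes_reindex, rimEdges_reindex]

/-- `W` is a section of `G` with lost edges `L` and boundary `B`: it is a subgraph of `G`
up to the edges of `L`, and only its vertices in `B` have neighbours outside `W`. -/
structure IsSection (W : OddWheel V q) (G : SimpleGraph V) (L : Set (Sym2 V)) (B : Set V) :
    Prop where
  adj_iff : ∀ x ∈ W.verts, ∀ y ∈ W.verts, G.Adj x y ↔ s(x, y) ∈ W.edges ∧ s(x, y) ∉ L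
  mem_verts : ∀ x ∈ W.verts, x ∉ B → ∀ y, G.Adj x y → y ∈ W.verts
  mem_boundary : ∀ x y, s(x, y) ∈ L → x ∈ B

namespace IsSection

variable {W : OddWheel V q} {G : SimpleGraph V} {L : Set (Sym2 V)} {B : Set V}

theorem reindex (hS : W.IsSection G L B) (t : ZMod (2 * q + 1)) (ε : ℤˣ) :
    (W.reindex t ε).IsSection G L B := by
  constructor
  · rw [verts_reindex, edges_reindex]; exact hS.adj_iff
  · rw [verts_reindex]; exact hS.mem_verts
  · exact hS.mem_boundary

theorem adj (hS : W.IsSection G L B) {x y : V} (h : s(x, y) ∈ W.edges) (hx : x ∉ B) :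
    G.Adj x y :=
  have hv := W.mem_verts_of_mem_edges h
  (hS.adj_iff x hv.1 y hv.2).2 ⟨h, fun h => hx (hS.mem_boundary _ _ h)⟩

theorem mem_edges (hS : W.IsSection G L B) {x y : V} (hx : x ∈ W.verts) (hy : y ∈ W.verts)
    (h : G.Adj x y) : s(x, y) ∈ W.edges :=
  ((hS.adj_iff x hx y hy).1 h).1

theorem rim_neighbors (hS : W.IsSection G L B) {j : ZMod (2 * q + 1)} (hj : W.rim j ∉ B) (u : V)
    (h : G.Adj (W.rim j) u) : u = W.rim (j - 1) ∨ u = W.rim (j + 1) ∨ u = W.hub := by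
  rcases hS.mem_verts _ (W.rim_mem_verts j) hj u h with rfl | ⟨i, rfl⟩
  · exact Or.inr (Or.inr rfl)
  · rcases W.rim_rim_mem_edges_iff.1
      (hS.mem_edges (W.rim_mem_verts j) (W.rim_mem_verts i) h) with rfl | rfl <;> simp

theorem adj_succ (hS : W.IsSection G L B) {j : ZMod (2 * q + 1)} (hj : W.rim j ∉ B) :
    G.Adj (W.rim j) (W.rim (j + 1)) :=
  hS.adj (W.rim_succ_mem_edges j) hj

theorem adj_pred (hS : W.IsSection G L B) {j : ZMod (2 * q + 1)} (hj : W.rim j ∉ B) :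
    G.Adj (W.rim j) (W.rim (j - 1)) :=
  hS.adj (W.rim_rim_mem_edges_iff.2 (by simp)) hj

theorem adj_hub (hS : W.IsSection G L B) {j : ZMod (2 * q + 1)} (hj : W.rim j ∉ B) :
    G.Adj (W.rim j) W.hub :=
  hS.adj (by rw [Sym2.eq_swap]; exact W.spike_mem_edges j) hj

end IsSection

/-- Rim positions at distance one to four along the rim differ as soon as the rim has five vertices;
the exclusion of larger wheels uses `2 ≤ q` in this form. -/
theorem _root_.ZMod.one_two_three_four_ne_zero {q : ℕ} (hq : 2 ≤ q) :
    (1 : ZMod (2 * q + 1)) ≠ 0 ∧ (2 : ZMod (2 * q + 1)) ≠ 0 ∧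
    (3 : ZMod (2 * q + 1)) ≠ 0 ∧ (4 : ZMod (2 * q + 1)) ≠ 0 := by
  refine ⟨?_, ?_, ?_, ?_⟩
  · exact_mod_cast ZMod.natCast_ne_zero_of_lt (n := 2 * q + 1) one_pos (by omega)
  · exact_mod_cast ZMod.natCast_ne_zero_of_lt (n := 2 * q + 1) two_pos (by omega)
  · exact_mod_cast ZMod.natCast_ne_zero_of_lt (n := 2 * q + 1) three_pos (by omega)
  · exact_mod_cast ZMod.natCast_ne_zero_of_lt (n := 2 * q + 1) four_pos (by omega)

/-- A rim edge can be made the first one by reading the rim suitably. -/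
theorem exists_reindex_of_mem_rimEdges (W : OddWheel V q) {a b : V} (h : s(a, b) ∈ W.rimEdges) :
    ∃ t ε, (W.reindex t ε).rim 0 = a ∧ (W.reindex t ε).rim 1 = b := by
  obtain ⟨j, hj⟩ := h
  rcases Sym2.eq_iff.1 hj with ⟨rfl, rfl⟩ | ⟨rfl, rfl⟩
  · exact ⟨j, 1, by simp [reindex], by simp [reindex]⟩
  · exact ⟨j + 1, -1, by simp [reindex], by simp [reindex]⟩

/-! ### Wheels with at least five spikes cannot be sections -/

variable {G : SimpleGraph V} {m : ℕ}

/-- In a quadrangulation, a section of a wheel with at least five spikes cannot have lost just two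
consecutive spikes. -/
theorem IsSection.false_of_lost_spikes {W : OddWheel V q} (hq : 2 ≤ q) (Q : Quadrangulation G m)
    (hS : W.IsSection G {s(W.hub, W.rim 0), s(W.hub, W.rim 1)} {W.hub, W.rim 0, W.rim 1}) :
    False := by
  obtain ⟨n1, n2, n3, n4⟩ := ZMod.one_two_three_four_ne_zero hq
  have inj : ∀ {i j}, W.rim i = W.rim j ↔ i = j := W.rim_injective.eq_iff
  have hB : ∀ j, j ≠ 0 → j ≠ 1 → W.rim j ∉ ({W.hub, W.rim 0, W.rim 1} : Set V) := by
    intro j h0 h1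
    simp [inj, W.rim_ne_hub, h0, h1]
  have b2 := hB 2 n2 (fun h => n1 (by linear_combination h))
  have b3 := hB 3 n3 (fun h => n2 (by linear_combination h))
  have e1 : (2 : ZMod (2 * q + 1)) - 1 = 1 := by ring
  have e2 : (2 : ZMod (2 * q + 1)) + 1 = 3 := by ring
  have e3 : (3 : ZMod (2 * q + 1)) - 1 = 2 := by ring
  have e4 : (3 : ZMod (2 * q + 1)) + 1 = 4 := by ring
  have a21 := hS.adj_pred b2
  have a23 := hS.adj_succ b2
  have a2N := hS.rim_neighbors b2
  have a3N := hS.rim_neighbors b3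
  have a3h := hS.adj_hub b3
  rw [e1] at a21 a2N
  rw [e2] at a23 a2N
  rw [e3, e4] at a3N
  -- At the rim vertex 2, its neighbours 1 and 3 need a second common neighbour. From 3 the options
  -- are 4, too far from 1, and the hub, whose spike to 1 is lost.
  obtain ⟨z, hz, h1, h3⟩ := Q.exists_common_neighbor a21 a23
    (inj.not.2 (fun h => n2 (by linear_combination -h))) a2N a3h (W.rim_ne_hub _).symm
  rcases a3N z h3 with rfl | rfl | rfl
  · exact hz rfl
  · have := W.rim_rim_mem_edges_iff.1 (hS.mem_edges (W.rim_mem_verts _) (W.rim_mem_verts _) h1)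
    rcases this with h | h
    · exact n2 (by linear_combination h)
    · exact n4 (by linear_combination -h)
  · have := (hS.adj_iff _ (W.rim_mem_verts _) _ W.hub_mem_verts).1 h1
    apply this.2
    right
    exact Sym2.eq_swap

/-- In a quadrangulation, a section of a wheel with at least five spikes cannot have lost just two
consecutive rim edges. -/
theorem IsSection.false_of_lost_rim_edges {W : OddWheel V q} (hq : 2 ≤ q)
    (Q : Quadrangulation G m)
    (hS : W.IsSection G {s(W.rim 0, W.rim 1), s(W.rim 0, W.rim (-1))}
      {W.rim 0, W.rim 1, W.rim (-1)}) : False := by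
  obtain ⟨n1, n2, n3, n4⟩ := ZMod.one_two_three_four_ne_zero hq
  have inj : ∀ {i j}, W.rim i = W.rim j ↔ i = j := W.rim_injective.eq_iff
  have b2 : W.rim 2 ∉ ({W.rim 0, W.rim 1, W.rim (-1)} : Set V) := by
    simp only [Set.mem_insert_iff, Set.mem_singleton_iff, inj]
    rintro (h | h | h)
    · exact n2 h
    · exact n1 (by linear_combination h)
    · exact n3 (by linear_combination h)
  have bh : W.hub ∉ ({W.rim 0, W.rim 1, W.rim (-1)} : Set V) := by
    simp [(W.rim_ne_hub _).symm]
  have e1 : (2 : ZMod (2 * q + 1)) - 1 = 1 := by ring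
  have a21 := hS.adj_pred b2
  have a2h := hS.adj_hub b2
  have a2N := hS.rim_neighbors b2
  rw [e1] at a21 a2N
  -- At the rim vertex 2, the neighbours used are 1 and the hub. The hub is not in the boundary, so
  -- the second common neighbour would be the rim vertex 0, whose edge to 1 is lost.
  obtain ⟨z, hz, h1, hh⟩ := Q.exists_common_neighbor a21 a2h (W.rim_ne_hub _)
    (fun u hu => by have := a2N u hu; tauto) (hS.adj (W.spike_mem_edges 0) bh)
    (by rw [Ne, inj]; exact n2.symm)
  rcases hS.mem_verts _ W.hub_mem_verts bh z hh with rfl | ⟨j, rfl⟩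
  · exact G.loopless.irrefl _ hh
  · obtain ⟨h1, h1'⟩ := (hS.adj_iff _ (W.rim_mem_verts _) _ (W.rim_mem_verts _)).1 h1
    rcases W.rim_rim_mem_edges_iff.1 h1 with h | h
    · exact hz (by rw [h]; congr 1; ring)
    · obtain rfl : j = 0 := by linear_combination -h
      exact h1' (Or.inl Sym2.eq_swap)

/-- In a quadrangulation, a section of a wheel with at least five spikes cannot have lost just a
spike and an adjacent rim edge. -/
theorem IsSection.false_of_lost_spike_rim_edge {W : OddWheel V q} (hq : 2 ≤ q)
    (Q : Quadrangulation G m)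
    (hS : W.IsSection G {s(W.rim 0, W.rim 1), s(W.rim 0, W.hub)} {W.rim 0, W.rim 1, W.hub}) :
    False := by
  obtain ⟨n1, n2, n3, n4⟩ := ZMod.one_two_three_four_ne_zero hq
  have inj : ∀ {i j}, W.rim i = W.rim j ↔ i = j := W.rim_injective.eq_iff
  have hB : ∀ j, j ≠ 0 → j ≠ 1 → W.rim j ∉ ({W.rim 0, W.rim 1, W.hub} : Set V) := by
    intro j h0 h1
    simp [inj, W.rim_ne_hub, h0, h1]
  have b1 := hB (-1) (fun h => n1 (by linear_combination -h))
    (fun h => n2 (by linear_combination -h))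
  have b2 := hB (-2) (fun h => n2 (by linear_combination -h))
    (fun h => n3 (by linear_combination -h))
  have e1 : (-1 : ZMod (2 * q + 1)) - 1 = -2 := by ring
  have e2 : (-1 : ZMod (2 * q + 1)) + 1 = 0 := by ring
  have e3 : (-2 : ZMod (2 * q + 1)) - 1 = -3 := by ring
  have e4 : (-2 : ZMod (2 * q + 1)) + 1 = -1 := by ring
  have a12 := hS.adj_pred b1
  have a10 := hS.adj_succ b1
  have a1N := hS.rim_neighbors b1
  have a2N := hS.rim_neighbors b2
  have a2h := hS.adj_hub b2
  rw [e1] at a12 a1N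
  rw [e2] at a10 a1N
  rw [e3, e4] at a2N
  -- At the rim vertex -1, on the side of 0 where no rim edge is lost, the neighbours 0 and -2 are
  -- used. From -2 the options are -3, too far from 0, and the hub, whose spike to 0 is lost.
  obtain ⟨z, hz, h0, h2⟩ := Q.exists_common_neighbor (w := W.hub) a10 a12
    (inj.not.2 (fun h => n2 (by linear_combination h))) (fun u hu => by have := a1N u hu; tauto) a2h
    (W.rim_ne_hub _).symm
  rcases a2N z h2 with rfl | rfl | rfl
  · have := W.rim_rim_mem_edges_iff.1 (hS.mem_edges (W.rim_mem_verts _) (W.rim_mem_verts _) h0)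
    rcases this with h | h
    · exact n4 (by linear_combination -h)
    · exact n2 (by linear_combination h)
  · exact hz rfl
  · have := (hS.adj_iff _ (W.rim_mem_verts _) _ W.hub_mem_verts).1 h0
    exact this.2 (Or.inr rfl)

/-- A wheel with at least five spikes is not a section of a plane multiwheel that quadrangulates
a surface. -/
theorem IsSection.false_of_plane {W : OddWheel V q} (hq : 2 ≤ q) (Q : Quadrangulation G m)
    {a b c : V} (hS : W.IsSection G {s(c, a), s(c, b)} {c, a, b}) (ha : s(c, a) ∈ W.edges)
    (hb : s(c, b) ∈ W.edges) (hab : a ≠ b) (hhub : W.hub = c → s(a, b) ∈ W.rimEdges) : False := by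
  -- The three positions of `c`: it is the hub; it is on the rim and one lost edge is a spike; or it
  -- is on the rim and both lost edges are rim edges.
  by_cases hc : W.hub = c
  · obtain ⟨t, ε, rfl, rfl⟩ := W.exists_reindex_of_mem_rimEdges (hhub hc)
    subst hc
    exact (hS.reindex t ε).false_of_lost_spikes hq Q
  · have spike : ∀ {a b : V}, W.IsSection G {s(c, a), s(c, b)} {c, a, b} → s(c, a) ∈ W.edges →
        a ≠ b → b = W.hub → False := by
      rintro a b hS ha hab rfl
      obtain ⟨t, ε, rfl, rfl⟩ := W.exists_reindex_of_mem_rimEdges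
        (W.mem_rimEdges_of_mem_edges ha (Ne.symm hc) hab)
      exact (hS.reindex t ε).false_of_lost_spike_rim_edge hq Q
    by_cases hbh : b = W.hub
    · exact spike hS ha hab hbh
    by_cases hah : a = W.hub
    · refine spike ?_ hb hab.symm hah
      rwa [Set.pair_comm, Set.pair_comm b a]
    obtain ⟨t, ε, rfl, rfl⟩ := W.exists_reindex_of_mem_rimEdges
      (W.mem_rimEdges_of_mem_edges ha (Ne.symm hc) hah)
    have hv := W.mem_verts_of_mem_edges hb
    rw [← W.verts_reindex t ε] at hv
    rw [← W.edges_reindex t ε] at hb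
    obtain ⟨j, rfl⟩ := hv.2.resolve_left hbh
    have hj : j = -1 := by
      rcases (rim_rim_mem_edges_iff _).1 hb with rfl | h
      · simp at hab
      · linear_combination -h
    subst hj
    exact (hS.reindex t ε).false_of_lost_rim_edges hq Q

/-- A wheel with at least five spikes is not an outer section of a projective-plane multiwheel that
quadrangulates a surface. -/
theorem IsSection.false_of_isLostPath {W : OddWheel V q} (hq : 2 ≤ q) (Q : Quadrangulation G m)
    {a h b d : V} (hS : W.IsSection G {s(a, h), s(h, b), s(b, d)} {a, h, b, d})
    (hW : W.IsLostPath a h b d) : False := by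
  obtain ⟨rfl, -, -, hab, hbd, had⟩ := hW
  obtain ⟨t, ε, rfl, rfl⟩ := W.exists_reindex_of_mem_rimEdges hab
  replace hS := hS.reindex t ε
  rw [← W.rimEdges_reindex t ε] at hbd
  have hh : W.hub = (W.reindex t ε).hub := rfl
  rw [hh] at hS
  generalize W.reindex t ε = W at hS hbd had
  obtain rfl : d = W.rim 2 := by
    obtain ⟨j, hj⟩ := hbd
    rcases Sym2.eq_iff.1 hj with ⟨h1, rfl⟩ | ⟨rfl, h1⟩
    · rw [W.rim_injective h1, one_add_one_eq_two]
    · have := W.rim_injective h1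
      exact absurd (by congr 1; linear_combination -this) had
  obtain ⟨n1, n2, n3, n4⟩ := ZMod.one_two_three_four_ne_zero hq
  have inj : ∀ {i j}, W.rim i = W.rim j ↔ i = j := W.rim_injective.eq_iff
  have hB : ∀ j, j ≠ 0 → j ≠ 1 → j ≠ 2 →
      W.rim j ∉ ({W.rim 0, W.hub, W.rim 1, W.rim 2} : Set V) := by
    intro j h0 h1 h2
    simp [inj, W.rim_ne_hub, h0, h1, h2]
  have b1 := hB (-1) (fun h => n1 (by linear_combination -h)) (fun h => n2 (by linear_combination -h))
    (fun h => n3 (by linear_combination -h))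
  have b2 := hB (-2) (fun h => n2 (by linear_combination -h))
    (fun h => n3 (by linear_combination -h))
    (fun h => n4 (by linear_combination -h))
  have e1 : (-1 : ZMod (2 * q + 1)) - 1 = -2 := by ring
  have e2 : (-1 : ZMod (2 * q + 1)) + 1 = 0 := by ring
  have e3 : (-2 : ZMod (2 * q + 1)) - 1 = -3 := by ring
  have e4 : (-2 : ZMod (2 * q + 1)) + 1 = -1 := by ring
  have a12 := hS.adj_pred b1
  have a10 := hS.adj_succ b1
  have a1N := hS.rim_neighbors b1
  have a2N := hS.rim_neighbors b2
  have a2h := hS.adj_hub b2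
  rw [e1] at a12 a1N
  rw [e2] at a10 a1N
  rw [e3, e4] at a2N
  -- The lost path is now 0, hub, 1, 2. Since `2 ≤ q`, both -1 and -2 avoid it, and of the lost
  -- edges only the spike to 0 matters.
  obtain ⟨z, hz, h0, h2⟩ := Q.exists_common_neighbor (w := W.hub) a10 a12
    (inj.not.2 (fun h => n2 (by linear_combination h))) (fun u hu => by have := a1N u hu; tauto) a2h
    (W.rim_ne_hub _).symm
  rcases a2N z h2 with rfl | rfl | rfl
  · have := W.rim_rim_mem_edges_iff.1 (hS.mem_edges (W.rim_mem_verts _) (W.rim_mem_verts _) h0)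
    rcases this with h | h
    · exact n4 (by linear_combination -h)
    · exact n2 (by linear_combination h)
  · exact hz rfl
  · have := (hS.adj_iff _ (W.rim_mem_verts _) _ W.hub_mem_verts).1 h0
    exact this.2 (Or.inl rfl)

end OddWheel

/-! ### Members of a sum modulo two are sections of it -/

section Sums

variable {V : Type*} {G : SimpleGraph V} {m : ℕ}

theorem mem_edgeSum {ι : Type*} {E : ι → Set (Sym2 V)} {e : Sym2 V} :
    e ∈ edgeSum E ↔ Odd {i | e ∈ E i}.ncard := Iff.rfl

theorem exists_mem_of_mem_edgeSum {ι : Type*} {E : ι → Set (Sym2 V)} {e : Sym2 V}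
    (he : e ∈ edgeSum E) : ∃ i, e ∈ E i := by
  by_contra! h
  rw [mem_edgeSum] at he
  simp [h] at he

namespace OddWheel

/-- A member of a sum of wheels is a section of the sum, if every two vertices which it shares with
another member span a lost edge, and every lost edge lies in exactly two members. -/
theorem isSection_of_edgeSum {ι : Type*} {vert : ι → Set V} {E : ι → Set (Sym2 V)}
    (hE : ∀ i x y, s(x, y) ∈ E i → x ∈ vert i ∧ y ∈ vert i ∧ x ≠ y)
    (hG : G.edgeSet = edgeSum E) {q : ℕ} {W : OddWheel V q} {i : ι} (hv : vert i = W.verts)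
    (he : E i = W.edges) {L : Set (Sym2 V)} {B : Set V}
    (hL : ∀ j ≠ i, ∀ x y, x ∈ vert i → x ∈ vert j → y ∈ vert i → y ∈ vert j → x ≠ y → s(x, y) ∈ L)
    (htwo : ∀ e ∈ L, ∃ j ≠ i, e ∈ E i ∧ e ∈ E j ∧ ∀ k, e ∈ E k → k = i ∨ k = j)
    (hB : ∀ j ≠ i, ∀ x, x ∈ vert i → x ∈ vert j → x ∈ B)
    (hLB : ∀ x y, s(x, y) ∈ L → x ∈ B) : W.IsSection G L B := by
  have hadj : ∀ x y, G.Adj x y ↔ s(x, y) ∈ edgeSum E := fun x y => by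
    rw [← hG, SimpleGraph.mem_edgeSet]
  refine ⟨fun x hx y hy => ?_, fun x hx hxB y hxy => ?_, hLB⟩
  · rw [← hv] at hx hy
    rw [hadj, ← he]
    constructor
    · intro h
      have hnot : s(x, y) ∉ L := by
        intro hl
        obtain ⟨j, hj, h1, h2, h3⟩ := htwo _ hl
        have : {k | s(x, y) ∈ E k} = {i, j} := by
          ext k
          constructor
          · exact h3 k
          · rintro (rfl | rfl)
            · exact h1
            · exact h2
        rw [mem_edgeSum, this, Set.ncard_pair hj.symm] at h
        exact absurd h (by decide)
      refine ⟨?_, hnot⟩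
      obtain ⟨k, hk⟩ := exists_mem_of_mem_edgeSum h
      rcases eq_or_ne k i with rfl | hki
      · exact hk
      · obtain ⟨h1, h2, h3⟩ := hE k x y hk
        exact absurd (hL k hki x y hx h1 hy h2 h3) hnot
    · rintro ⟨h1, h2⟩
      have : {k | s(x, y) ∈ E k} = {i} := by
        ext k
        constructor
        · intro hk
          by_contra hki
          obtain ⟨h3, h4, h5⟩ := hE k x y hk
          exact h2 (hL k hki x y hx h3 hy h4 h5)
        · rintro rfl
          exact h1
      rw [mem_edgeSum, this, Set.ncard_singleton]
      exact odd_one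
  · rw [← hv] at hx ⊢
    obtain ⟨k, hk⟩ := exists_mem_of_mem_edgeSum ((hadj x y).1 hxy)
    obtain ⟨h1, h2, -⟩ := hE k x y hk
    rcases eq_or_ne k i with rfl | hki
    · exact h2
    · exact absurd (hB k hki x hx h1) hxB

theorem IsLostPath.edges_ne {q : ℕ} (hq : 1 ≤ q) {W : OddWheel V q} {a h b d : V}
    (hW : W.IsLostPath a h b d) :
    (s(a, h) ∈ W.edges ∧ s(h, b) ∈ W.edges ∧ s(b, d) ∈ W.edges) ∧
      a ≠ h ∧ a ≠ b ∧ a ≠ d ∧ h ≠ b ∧ h ≠ d ∧ b ≠ d := by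
  obtain ⟨rfl, ha, hb, hab, hbd, had⟩ := hW
  have ha' : s(a, W.hub) ∈ W.edges := by rw [Sym2.eq_swap]; exact Or.inl ha
  have hd : W.hub ≠ d := by
    obtain ⟨j, hj⟩ := hbd
    rcases Sym2.eq_iff.1 hj with ⟨-, rfl⟩ | ⟨rfl, -⟩ <;> exact (W.rim_ne_hub _).symm
  exact ⟨⟨ha', Or.inl hb, Or.inr hbd⟩, W.ne_of_mem_edges hq ha', W.ne_of_mem_edges hq (Or.inr hab),
    had, W.ne_of_mem_edges hq (Or.inl hb), hd, W.ne_of_mem_edges hq (Or.inr hbd)⟩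

end OddWheel

theorem ZMod.one_two_ne_zero {p : ℕ} (hp : 1 ≤ p) :
    (1 : ZMod (2 * p + 1)) ≠ 0 ∧ (2 : ZMod (2 * p + 1)) ≠ 0 :=
  ⟨by exact_mod_cast ZMod.natCast_ne_zero_of_lt (n := 2 * p + 1) one_pos (by omega),
    by exact_mod_cast ZMod.natCast_ne_zero_of_lt (n := 2 * p + 1) two_pos (by omega)⟩

section Plane

variable {p : ℕ} {q : ZMod (2 * p + 1) → ℕ} {W : ∀ i, OddWheel V (q i)} {c : V}
  {v : ZMod (2 * p + 1) → V}

theorem mem_two_plane_wheels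
    (hcons : ∀ i, (W i).verts ∩ (W (i + 1)).verts = {c, v (i + 1)})
    (hnon : ∀ i j, i ≠ j → j ≠ i + 1 → i ≠ j + 1 → (W i).verts ∩ (W j).verts = {c})
    {i j : ZMod (2 * p + 1)} (hij : i ≠ j) {x : V} (hi : x ∈ (W i).verts) (hj : x ∈ (W j).verts)
    (hx : x ≠ c) : (j = i + 1 ∧ x = v (i + 1)) ∨ (i = j + 1 ∧ x = v i) := by
  by_cases h1 : j = i + 1
  · subst h1
    have : x ∈ ({c, v (i + 1)} : Set V) := hcons i ▸ ⟨hi, hj⟩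
    exact Or.inl ⟨rfl, this.resolve_left hx⟩
  by_cases h2 : i = j + 1
  · subst h2
    have : x ∈ ({c, v (j + 1)} : Set V) := hcons j ▸ ⟨hj, hi⟩
    exact Or.inr ⟨rfl, this.resolve_left hx⟩
  have : x ∈ ({c} : Set V) := hnon i j hij h1 h2 ▸ ⟨hi, hj⟩
  exact absurd this hx

/-- Two wheels share, besides `c`, at most one vertex `v j`, so they span at most the lost edge
`s(c, v j)`. As there are at least three wheels and the `v j` are distinct, this edge lies in two
wheels only and cancels. -/
theorem isSection_plane (hp : 1 ≤ p) (hq : ∀ i, 1 ≤ q i) (hv : Function.Injective v)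
    (hlost : ∀ i, s(c, v i) ∈ (W i).edges ∧ s(c, v (i + 1)) ∈ (W i).edges)
    (hcons : ∀ i, (W i).verts ∩ (W (i + 1)).verts = {c, v (i + 1)})
    (hnon : ∀ i j, i ≠ j → j ≠ i + 1 → i ≠ j + 1 → (W i).verts ∩ (W j).verts = {c})
    (hG : G.edgeSet = edgeSum fun i => (W i).edges) (i : ZMod (2 * p + 1)) :
    (W i).IsSection G {s(c, v i), s(c, v (i + 1))} {c, v i, v (i + 1)} := by
  obtain ⟨n1, n2⟩ := ZMod.one_two_ne_zero hp
  have hc : ∀ i, v i ≠ c := fun i => ((W i).ne_of_mem_edges (hq i) (hlost i).1).symm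
  have vi : ∀ i, v i ∈ (W i).verts := fun i => ((W i).mem_verts_of_mem_edges (hlost i).1).2
  have vi' : ∀ i, v (i + 1) ∈ (W i).verts := fun i =>
    ((W i).mem_verts_of_mem_edges (hlost i).2).2
  have hne : ∀ i, v i ≠ v (i + 1) := fun i h => n1 (by simpa using hv h)
  have key := @mem_two_plane_wheels V p q W c v hcons hnon
  refine OddWheel.isSection_of_edgeSum (vert := fun i => (W i).verts) ?_ hG rfl rfl ?_ ?_ ?_ ?_
  · intro i x y h
    have := (W i).mem_verts_of_mem_edges h
    exact ⟨this.1, this.2, (W i).ne_of_mem_edges (hq i) h⟩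
  · intro j hj x y hx hx' hy hy' hxy
    have kx := key hj.symm hx hx'
    have ky := key hj.symm hy hy'
    have e : ∀ x, s(x, c) = s(c, x) := fun x => Sym2.eq_swap
    by_cases hxc : x = c
    · subst hxc
      rcases ky hxy.symm with ⟨-, rfl⟩ | ⟨-, rfl⟩ <;> simp
    · by_cases hyc : y = c
      · subst hyc
        rcases kx hxc with ⟨-, rfl⟩ | ⟨-, rfl⟩ <;> simp [e]
      · rcases kx hxc with ⟨h1, h2⟩ | ⟨h1, h2⟩ <;> rcases ky hyc with ⟨h3, h4⟩ | ⟨h3, h4⟩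
        · exact absurd (h2.trans h4.symm) hxy
        -- A wheel cannot be both the successor and the predecessor of another: this would need a
        -- cycle of two wheels.
        · exact absurd (by linear_combination h3 + h1) (neg_ne_zero.2 n2)
        · exact absurd (by linear_combination h3 + h1) (neg_ne_zero.2 n2)
        · exact absurd (h2.trans h4.symm) hxy
  · rintro e (rfl | rfl)
    · refine ⟨i - 1, by simpa using n1, (hlost i).1, ?_, fun k hk => ?_⟩
      · have := (hlost (i - 1)).2
        rwa [sub_add_cancel] at this
      · by_contra! hcon
        rcases key hcon.1.symm (vi i) ((W k).mem_verts_of_mem_edges hk).2 (hc i) with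
          ⟨-, h⟩ | ⟨h, -⟩
        · exact hne _ h
        · exact hcon.2 (by rw [h]; ring)
    · refine ⟨i + 1, by simpa using n1, (hlost i).2, (hlost (i + 1)).1, fun k hk => ?_⟩
      by_contra! hcon
      rcases key hcon.1.symm (vi' i) ((W k).mem_verts_of_mem_edges hk).2 (hc _) with
        ⟨h, -⟩ | ⟨-, h⟩
      · exact hcon.2 h
      · exact hne _ h.symm
  · intro j hj x hx hx'
    by_cases hxc : x = c
    · simp [hxc]
    · rcases key hj.symm hx hx' hxc with ⟨-, rfl⟩ | ⟨-, rfl⟩ <;> simp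
  · rintro x y (h | h) <;> rcases Sym2.eq_iff.1 h with ⟨rfl, rfl⟩ | ⟨rfl, rfl⟩ <;> simp

end Plane

section Projective

variable {p : ℕ} {q : ZMod (2 * p + 1) → ℕ} {W : ∀ i, OddWheel V (q i)} {C : OddWheel V p}
  {o : ZMod (2 * p + 1) → V}

theorem mem_two_projective_wheels
    (hcons : ∀ i, (W i).verts ∩ (W (i + 1)).verts = {C.rim (i + 1), o (i + 1)})
    (hnon : ∀ i j, i ≠ j → j ≠ i + 1 → i ≠ j + 1 → Disjoint (W i).verts (W j).verts)
    {i j : ZMod (2 * p + 1)} (hij : i ≠ j) {x : V} (hi : x ∈ (W i).verts) (hj : x ∈ (W j).verts) :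
    (j = i + 1 ∧ (x = C.rim (i + 1) ∨ x = o (i + 1))) ∨
      (i = j + 1 ∧ (x = C.rim i ∨ x = o i)) := by
  by_cases h1 : j = i + 1
  · subst h1
    have : x ∈ ({C.rim (i + 1), o (i + 1)} : Set V) := hcons i ▸ ⟨hi, hj⟩
    exact Or.inl ⟨rfl, this⟩
  by_cases h2 : i = j + 1
  · subst h2
    have : x ∈ ({C.rim (j + 1), o (j + 1)} : Set V) := hcons j ▸ ⟨hj, hi⟩
    exact Or.inr ⟨rfl, this⟩
  exact absurd hj (Set.disjoint_left.1 (hnon i j hij h1 h2) hi)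

theorem isSection_projective (hp : 1 ≤ p) (hq : ∀ i, 1 ≤ q i)
    (hlost : ∀ i, (W i).IsLostPath (o i) (C.rim i) (C.rim (i + 1)) (o (i + 1)) ∨
      (W i).IsLostPath (o (i + 1)) (C.rim (i + 1)) (C.rim i) (o i))
    (hC : ∀ i, (W i).verts ∩ C.verts = {C.rim i, C.rim (i + 1)})
    (hcons : ∀ i, (W i).verts ∩ (W (i + 1)).verts = {C.rim (i + 1), o (i + 1)})
    (hnon : ∀ i j, i ≠ j → j ≠ i + 1 → i ≠ j + 1 → Disjoint (W i).verts (W j).verts)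
    (hG : G.edgeSet =
      edgeSum fun i : Option (ZMod (2 * p + 1)) => i.elim C.edges fun i => (W i).edges)
    (i : ZMod (2 * p + 1)) :
    (W i).IsSection G {s(o i, C.rim i), s(C.rim i, C.rim (i + 1)), s(C.rim (i + 1), o (i + 1))}
      {o i, C.rim i, C.rim (i + 1), o (i + 1)} := by
  obtain ⟨n1, n2⟩ := ZMod.one_two_ne_zero hp
  -- What follows needs only the edges of the lost path and the distinctness of its vertices, which
  -- do not depend on the direction of reading.
  have hpath : ∀ i, (s(o i, C.rim i) ∈ (W i).edges ∧ s(C.rim i, C.rim (i + 1)) ∈ (W i).edges ∧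
      s(C.rim (i + 1), o (i + 1)) ∈ (W i).edges) ∧ o i ≠ C.rim i ∧ o i ≠ C.rim (i + 1) ∧
      o i ≠ o (i + 1) ∧ C.rim i ≠ C.rim (i + 1) ∧ C.rim i ≠ o (i + 1) ∧
      C.rim (i + 1) ≠ o (i + 1) := by
    intro i
    rcases hlost i with h | h
    · exact h.edges_ne (hq i)
    · obtain ⟨⟨h1, h2, h3⟩, h4, h5, h6, h7, h8, h9⟩ := h.edges_ne (hq i)
      rw [Sym2.eq_swap] at h1 h2 h3
      exact ⟨⟨h3, h2, h1⟩, h9.symm, h8.symm, h6.symm, h7.symm, h5.symm, h4.symm⟩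
  have key := @mem_two_projective_wheels V p q W C o hcons hnon
  have keyC : ∀ {i x}, x ∈ (W i).verts → x ∈ C.verts → x = C.rim i ∨ x = C.rim (i + 1) := by
    intro i x h1 h2
    have : x ∈ ({C.rim i, C.rim (i + 1)} : Set V) := hC i ▸ ⟨h1, h2⟩
    exact this
  obtain ⟨⟨e1, e2, e3⟩, d1, d2, d3, d4, d5, d6⟩ := hpath i
  have v1 := (W i).mem_verts_of_mem_edges e1
  have v3 := (W i).mem_verts_of_mem_edges e3
  have swap : ∀ x y : V, s(x, y) = s(y, x) := fun x y => Sym2.eq_swap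
  refine OddWheel.isSection_of_edgeSum (i := some i)
    (vert := fun i : Option (ZMod (2 * p + 1)) => i.elim C.verts fun i => (W i).verts)
    ?_ hG rfl rfl ?_ ?_ ?_ ?_
  · rintro (_ | i) x y h
    · have := C.mem_verts_of_mem_edges h
      exact ⟨this.1, this.2, C.ne_of_mem_edges hp h⟩
    · have := (W i).mem_verts_of_mem_edges h
      exact ⟨this.1, this.2, (W i).ne_of_mem_edges (hq i) h⟩
  · rintro (_ | j) hj x y hx hx' hy hy' hxy
    · rcases keyC hx hx' with rfl | rfl <;> rcases keyC hy hy' with rfl | rfl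
      · exact absurd rfl hxy
      · simp
      · rw [swap]; simp
      · exact absurd rfl hxy
    · have hij : i ≠ j := fun h => hj (congrArg some h.symm)
      rcases key hij hx hx' with ⟨h1, h2⟩ | ⟨h1, h2⟩ <;>
        rcases key hij hy hy' with ⟨h3, h4⟩ | ⟨h3, h4⟩
      · rcases h2 with rfl | rfl <;> rcases h4 with rfl | rfl
        · exact absurd rfl hxy
        · simp
        · rw [swap]; simp
        · exact absurd rfl hxy
      · exact absurd (by linear_combination h3 + h1) (neg_ne_zero.2 n2)
      · exact absurd (by linear_combination h3 + h1) (neg_ne_zero.2 n2)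
      · rcases h2 with rfl | rfl <;> rcases h4 with rfl | rfl
        · exact absurd rfl hxy
        · rw [swap]; simp
        · simp
        · exact absurd rfl hxy
  · rintro e (rfl | rfl | rfl)
    · refine ⟨some (i - 1), by simpa using n1, e1, ?_, ?_⟩
      · have := (hpath (i - 1)).1.2.2
        rw [sub_add_cancel, swap] at this
        exact this
      · rintro (_ | k) hk
        · rcases keyC v1.1 (C.mem_verts_of_mem_edges hk).1 with h | h
          · exact absurd h d1
          · exact absurd h d2
        · by_contra! hcon
          have hik : i ≠ k := fun h => hcon.1 (congrArg some h.symm)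
          rcases key hik v1.1 ((W k).mem_verts_of_mem_edges hk).1 with ⟨-, h | h⟩ | ⟨h, -⟩
          · exact d2 h
          · exact d3 h
          · exact hcon.2 (by rw [h, add_sub_cancel_right])
    · refine ⟨none, by simp, e2, C.rim_succ_mem_edges i, ?_⟩
      rintro (_ | k) hk
      · exact Or.inr rfl
      · by_contra! hcon
        have hik : i ≠ k := fun h => hcon.1 (congrArg some h.symm)
        have hv := (W k).mem_verts_of_mem_edges hk
        rcases key hik v1.2 hv.1 with ⟨-, h | h⟩ | ⟨h, -⟩
        · exact d4 h
        · exact d5 h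
        · rcases key hik v3.1 hv.2 with ⟨h', -⟩ | ⟨-, h' | h'⟩
          · exact absurd (by linear_combination h' + h) (neg_ne_zero.2 n2)
          · exact d4 h'.symm
          · exact d2 h'.symm
    · refine ⟨some (i + 1), by simpa using n1, e3, ?_, ?_⟩
      · have := (hpath (i + 1)).1.1
        rw [swap] at this
        exact this
      · rintro (_ | k) hk
        · rcases keyC v3.2 (C.mem_verts_of_mem_edges hk).2 with h | h
          · exact absurd h.symm d5
          · exact absurd h.symm d6
        · by_contra! hcon
          have hik : i ≠ k := fun h => hcon.1 (congrArg some h.symm)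
          rcases key hik v3.2 ((W k).mem_verts_of_mem_edges hk).2 with ⟨h, -⟩ | ⟨-, h | h⟩
          · exact hcon.2 (by rw [h])
          · exact d5 h.symm
          · exact d3 h.symm
  · rintro (_ | j) hj x hx hx'
    · rcases keyC hx hx' with rfl | rfl <;> simp
    · have hij : i ≠ j := fun h => hj (congrArg some h.symm)
      rcases key hij hx hx' with ⟨-, rfl | rfl⟩ | ⟨-, rfl | rfl⟩ <;> simp
  · rintro x y (h | h | h) <;> rcases Sym2.eq_iff.1 h with ⟨rfl, rfl⟩ | ⟨rfl, rfl⟩ <;> simp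

/-- A projective-plane multiwheel that quadrangulates a surface has only triangular outer
wheels. -/
theorem IsProjectiveMultiwheel.isGrotzschClass (hG : IsProjectiveMultiwheel G)
    (Q : Quadrangulation G m) : IsGrotzschClass G := by
  obtain ⟨p, q, hp, hq, hsum⟩ := hG
  have hq1 : q = fun _ => 1 := by
    obtain ⟨W, C, o, -, -, hlost, hC, hcons, hnon, hG⟩ := hsum
    funext i
    by_contra hqi
    have hS := isSection_projective hp hq hlost hC hcons hnon hG i
    have hqi2 : 2 ≤ q i := by have := hq i; omega
    rcases hlost i with h | h
    · exact hS.false_of_isLostPath hqi2 Q h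
    · refine OddWheel.IsSection.false_of_isLostPath hqi2 Q ?_ h
      -- Reversing the path changes neither the set of lost edges nor the boundary.
      convert hS using 1
      · rw [Sym2.eq_swap (a := C.rim i) (b := o i),
          Sym2.eq_swap (a := C.rim (i + 1)) (b := C.rim i),
          Sym2.eq_swap (a := o (i + 1))]
        ext; simp only [Set.mem_insert_iff, Set.mem_singleton_iff]; tauto
      · ext; simp only [Set.mem_insert_iff, Set.mem_singleton_iff]; tauto
  subst hq1
  exact ⟨p, hp, hsum⟩

end Projective

end Sums

/-! ### Images of wheels, and triangular wheels as complete graphs -/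

namespace OddWheel

variable {V T : Type*} {q : ℕ}

/-- The image of a wheel under an injective map. -/
def map (W : OddWheel T q) (φ : T ↪ V) : OddWheel V q where
  hub := φ W.hub
  rim j := φ (W.rim j)
  rim_injective := φ.injective.comp W.rim_injective
  rim_ne_hub j := φ.injective.ne (W.rim_ne_hub j)

theorem verts_map (W : OddWheel T q) (φ : T ↪ V) : (W.map φ).verts = φ '' W.verts := by
  rw [verts, verts, Set.image_insert_eq, ← Set.range_comp]
  rfl

theorem spikes_map (W : OddWheel T q) (φ : T ↪ V) :
    (W.map φ).spikes = Sym2.map φ '' W.spikes := by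
  rw [spikes, spikes, ← Set.range_comp]
  rfl

theorem rimEdges_map (W : OddWheel T q) (φ : T ↪ V) :
    (W.map φ).rimEdges = Sym2.map φ '' W.rimEdges := by
  rw [rimEdges, rimEdges, ← Set.range_comp]
  rfl

theorem edges_map (W : OddWheel T q) (φ : T ↪ V) :
    (W.map φ).edges = Sym2.map φ '' W.edges := by
  rw [edges, edges, spikes_map, rimEdges_map, Set.image_union]

theorem IsLostPath.map {W : OddWheel T q} (φ : T ↪ V) {a h b d : T} (hW : W.IsLostPath a h b d) :
    (W.map φ).IsLostPath (φ a) (φ h) (φ b) (φ d) := by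
  obtain ⟨h1, h2, h3, h4, h5, h6⟩ := hW
  refine ⟨congrArg φ h1, ?_, ?_, ?_, ?_, φ.injective.ne h6⟩
  · rw [spikes_map]; exact ⟨_, h2, rfl⟩
  · rw [spikes_map]; exact ⟨_, h3, rfl⟩
  · rw [rimEdges_map]; exact ⟨_, h4, rfl⟩
  · rw [rimEdges_map]; exact ⟨_, h5, rfl⟩

theorem verts_eq_of_one (W : OddWheel V 1) :
    W.verts = {W.hub, W.rim 0, W.rim 1, W.rim 2} := by
  rw [verts]
  congr 1
  ext x
  simp only [Set.mem_range, Set.mem_insert_iff, Set.mem_singleton_iff]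
  constructor
  · rintro ⟨j, rfl⟩
    have : j = 0 ∨ j = 1 ∨ j = 2 := by revert j; decide
    rcases this with rfl | rfl | rfl <;> simp
  · rintro (rfl | rfl | rfl) <;> exact ⟨_, rfl⟩

/-- A wheel with three spikes is a complete graph. -/
theorem mem_edges_iff_of_one (W : OddWheel V 1) {x y : V} :
    s(x, y) ∈ W.edges ↔ x ∈ W.verts ∧ y ∈ W.verts ∧ x ≠ y := by
  constructor
  · intro h
    have := W.mem_verts_of_mem_edges h
    exact ⟨this.1, this.2, W.ne_of_mem_edges le_rfl h⟩
  · rintro ⟨rfl | ⟨i, rfl⟩, rfl | ⟨j, rfl⟩, hne⟩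
    · exact absurd rfl hne
    · exact W.spike_mem_edges j
    · rw [Sym2.eq_swap]; exact W.spike_mem_edges i
    · rw [rim_rim_mem_edges_iff]
      have hij : i ≠ j := fun h => hne (congrArg _ h)
      clear hne
      revert i j
      decide

theorem ncard_verts (W : OddWheel V q) : W.verts.ncard = 2 * q + 2 := by
  rw [verts, Set.ncard_insert_of_notMem (by rintro ⟨j, hj⟩; exact W.rim_ne_hub j hj)
    (Set.toFinite _), ← Set.image_univ, Set.ncard_image_of_injective _ W.rim_injective,
    Set.ncard_univ, Nat.card_zmod]

/-- Three vertices of a wheel with three spikes leave exactly one other vertex. -/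
theorem exists_fourth_vertex (W : OddWheel V 1) {a b c : V} (ha : a ∈ W.verts) (hb : b ∈ W.verts)
    (hc : c ∈ W.verts) (hab : a ≠ b) (hac : a ≠ c) (hbc : b ≠ c) :
    ∃ u, u ≠ a ∧ u ≠ b ∧ u ≠ c ∧ W.verts = {c, a, b, u} := by
  have hsub : ({c, a, b} : Set V) ⊆ W.verts := by
    rintro x (rfl | rfl | rfl) <;> assumption
  have h3 : ({c, a, b} : Set V).ncard = 3 := Set.ncard_eq_three.2 ⟨c, a, b, hac.symm, hbc.symm,
    hab, rfl⟩
  have h1 : (W.verts \ {c, a, b}).ncard = 1 := by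
    rw [Set.ncard_sdiff hsub (Set.toFinite _), h3, ncard_verts]
  obtain ⟨u, hu⟩ := Set.ncard_eq_one.1 h1
  have hmem : u ∈ W.verts \ {c, a, b} := hu ▸ rfl
  have hn := hmem.2
  simp only [Set.mem_insert_iff, Set.mem_singleton_iff, not_or] at hn
  refine ⟨u, hn.2.1, hn.2.2, hn.1, ?_⟩
  ext x
  have hx : x ∈ W.verts \ {c, a, b} ↔ x = u := by rw [hu]; rfl
  have hs := @hsub x
  simp only [Set.mem_sdiff, Set.mem_insert_iff, Set.mem_singleton_iff] at hx hs ⊢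
  clear hu hmem
  grind

end OddWheel

/-- Projective-plane sums of wheels are preserved by isomorphisms. -/
theorem IsProjectiveWheelSum.of_equiv {V T : Type*} {G : SimpleGraph V} {H : SimpleGraph T}
    {p : ℕ} {q : ZMod (2 * p + 1) → ℕ} (φ : T ≃ V) (hφ : ∀ x y, G.Adj (φ x) (φ y) ↔ H.Adj x y)
    (hH : IsProjectiveWheelSum H p q) : IsProjectiveWheelSum G p q := by
  obtain ⟨W, C, o, hV, ho, hlost, hC, hcons, hnon, hsum⟩ := hH
  let f : T ↪ V := φ.toEmbedding
  refine ⟨fun i => (W i).map f, C.map f, fun i => f (o i), ?_, f.injective.comp ho, ?_, ?_, ?_, ?_,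
    ?_⟩
  · intro x
    simp only [OddWheel.verts_map]
    rcases hV (φ.symm x) with h | ⟨i, h⟩
    · exact Or.inl ⟨_, h, φ.apply_symm_apply x⟩
    · exact Or.inr ⟨i, _, h, φ.apply_symm_apply x⟩
  · exact fun i => (hlost i).imp (fun h => h.map f) (fun h => h.map f)
  · intro i
    rw [OddWheel.verts_map, OddWheel.verts_map, ← Set.image_inter f.injective, hC, Set.image_pair]
    rfl
  · intro i
    rw [OddWheel.verts_map, OddWheel.verts_map, ← Set.image_inter f.injective, hcons,
      Set.image_pair]
    rfl
  · intro i j h1 h2 h3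
    rw [OddWheel.verts_map, OddWheel.verts_map, Set.disjoint_image_iff f.injective]
    exact hnon i j h1 h2 h3
  · ext e
    obtain ⟨e, rfl⟩ : ∃ e', Sym2.map φ e' = e :=
      ⟨Sym2.map φ.symm e, by rw [Sym2.map_map]; simp⟩
    have h1 : Sym2.map φ e ∈ G.edgeSet ↔ e ∈ H.edgeSet := by
      induction e with | _ x y => exact hφ x y
    have h2 : ∀ i : Option (ZMod (2 * p + 1)),
        Sym2.map φ e ∈ i.elim (C.map f).edges (fun i => ((W i).map f).edges) ↔
          e ∈ i.elim C.edges (fun i => (W i).edges) := by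
      have inj : Function.Injective (Sym2.map f) := Sym2.map.injective f.injective
      rintro (_ | i)
      · simp only [Option.elim, OddWheel.edges_map]
        exact inj.mem_set_image
      · simp only [Option.elim, OddWheel.edges_map]
        exact inj.mem_set_image
    rw [h1, hsum, mem_edgeSum, mem_edgeSum]
    simp only [h2]

/-! ### Two presentations of the sum of three triangular wheels -/

/-- The vertices of the sum of three triangular wheels with a common vertex: this vertex, the
vertices `(false, i)` common to consecutive wheels, and the remaining vertices `(true, i)`. -/
abbrev TriangleVertex : Type := Option (Bool × ZMod (2 * 1 + 1))

namespace TriangleVertex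

/-- The vertices of the `i`-th of the three wheels of the plane sum. -/
def planeSection (i : ZMod (2 * 1 + 1)) : Finset TriangleVertex :=
  {none, some (false, i), some (false, i + 1), some (true, i)}

/-- The plane sum of three triangular wheels. -/
def planeSum : SimpleGraph TriangleVertex where
  Adj x y := Odd (Finset.univ.filter fun i =>
    x ≠ y ∧ x ∈ planeSection i ∧ y ∈ planeSection i).card
  symm := ⟨by
    intro x y h
    simpa only [ne_comm (a := y), and_comm (a := y ∈ _)] using h⟩
  loopless := ⟨by
    intro x h
    simp at h⟩

/-- The outer wheels of `planeSum`, seen as a projective-plane sum. -/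
def outerWheel (i : ZMod (2 * 1 + 1)) : OddWheel TriangleVertex 1 where
  hub := some (true, i + 1)
  rim j := if j = 0 then some (false, i) else if j = 1 then some (true, i + 2) else
    some (false, i + 1)
  rim_injective := by revert i; decide
  rim_ne_hub := by revert i; decide

/-- The central wheel of `planeSum`, seen as a projective-plane sum. -/
def centralWheel : OddWheel TriangleVertex 1 where
  hub := none
  rim i := some (true, i + 1)
  rim_injective := by decide
  rim_ne_hub := by decide

/-- The vertices of the wheels of the projective-plane sum. -/
def projectiveSection : Option (ZMod (2 * 1 + 1)) → Finset TriangleVertex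
  | none => {none, some (true, 1), some (true, 2), some (true, 0)}
  | some i => {some (true, i + 1), some (false, i), some (true, i + 2), some (false, i + 1)}

theorem verts_centralWheel : centralWheel.verts = projectiveSection none := by
  rw [OddWheel.verts_eq_of_one]
  simp only [projectiveSection, Finset.coe_insert, Finset.coe_singleton]
  rfl

theorem verts_outerWheel (i : ZMod (2 * 1 + 1)) :
    (outerWheel i).verts = projectiveSection (some i) := by
  rw [OddWheel.verts_eq_of_one]
  simp only [projectiveSection, Finset.coe_insert, Finset.coe_singleton]
  rfl

theorem isLostPath_outerWheel (i : ZMod (2 * 1 + 1)) :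
    (outerWheel i).IsLostPath (some (false, i)) (some (true, i + 1)) (some (true, i + 1 + 1))
      (some (false, i + 1)) := by
  have h : i + 1 + 1 = i + 2 := by ring
  rw [h]
  refine ⟨rfl, ⟨0, rfl⟩, ⟨1, rfl⟩, ⟨0, rfl⟩, ⟨1, rfl⟩, ?_⟩
  revert i
  decide

/-- The plane sum of three triangular wheels is also a projective-plane sum of such wheels. -/
theorem isProjectiveWheelSum_planeSum : IsProjectiveWheelSum planeSum 1 fun _ => 1 := by
  -- Edges between `o i` and `n i` have to cancel, so with `o i` the vertex `(false, i)`, its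
  -- partner `n i` is the only `(true, j)` not adjacent to it, namely `(true, i + 1)`. The hub of
  -- the central wheel is the old common vertex.
  refine ⟨outerWheel, centralWheel, fun i => some (false, i), ?_, by decide,
    fun i => Or.inl (isLostPath_outerWheel i), ?_, ?_, ?_, ?_⟩
  · simp only [verts_centralWheel, verts_outerWheel, Finset.mem_coe]
    decide
  · intro i
    rw [verts_centralWheel, verts_outerWheel, ← Finset.coe_inter, ← Finset.coe_pair,
      Finset.coe_inj]
    revert i
    decide
  · intro i
    rw [verts_outerWheel, verts_outerWheel, ← Finset.coe_inter, ← Finset.coe_pair,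
      Finset.coe_inj]
    revert i
    decide
  · intro i j h1 h2 h3
    -- Among three cyclic indices any two are consecutive.
    exact absurd h3 ((by decide : ∀ i j : ZMod (2 * 1 + 1), i ≠ j → j ≠ i + 1 → ¬ i ≠ j + 1)
      i j h1 h2)
  · ext e
    induction e with | _ x y
    -- All wheels being complete graphs, an edge lies in one exactly when its ends do; both
    -- presentations become parity counts on seven vertices.
    have h : {k : Option (ZMod (2 * 1 + 1)) |
        s(x, y) ∈ k.elim centralWheel.edges (fun i => (outerWheel i).edges)} =
          (Finset.univ.filter fun k => x ≠ y ∧ x ∈ projectiveSection k ∧ y ∈ projectiveSection k :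
            Finset (Option (ZMod (2 * 1 + 1)))) := by
      ext (_ | i) <;>
        simp [OddWheel.mem_edges_iff_of_one, verts_centralWheel, verts_outerWheel] <;> tauto
    rw [mem_edgeSum, h, Set.ncard_coe_finset]
    clear h
    change planeSum.Adj x y ↔ _
    revert x y
    unfold planeSum
    decide

end TriangleVertex

/-! ### Plane multiwheels -/

section Plane

variable {V : Type*} {G : SimpleGraph V} {m : ℕ}

/-- In a quadrangulation, a plane sum of triangular wheels has only three members. -/
theorem eq_one_of_plane_triangular {p : ℕ} (hp : 1 ≤ p) (Q : Quadrangulation G m)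
    {W : ZMod (2 * p + 1) → OddWheel V 1} {c : V} {v u : ZMod (2 * p + 1) → V}
    (hv : Function.Injective v) (hvc : ∀ i, v i ≠ c)
    (hu : ∀ i, u i ≠ v i ∧ u i ≠ v (i + 1) ∧ u i ≠ c)
    (hW : ∀ i, (W i).verts = {c, v i, v (i + 1), u i})
    (hcons : ∀ i, (W i).verts ∩ (W (i + 1)).verts = {c, v (i + 1)})
    (hnon : ∀ i j, i ≠ j → j ≠ i + 1 → i ≠ j + 1 → (W i).verts ∩ (W j).verts = {c})
    (hS : ∀ i, (W i).IsSection G {s(c, v i), s(c, v (i + 1))} {c, v i, v (i + 1)})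
    (hG : G.edgeSet = edgeSum fun i => (W i).edges) : p = 1 := by
  by_contra hp1
  obtain ⟨n1, n2, n3, -⟩ := ZMod.one_two_three_four_ne_zero (q := p) (by omega)
  have key := @mem_two_plane_wheels V p (fun _ => 1) W c v hcons hnon
  have hne : v 0 ≠ v (0 + 1) := fun h => n1 (by simpa using (hv h).symm)
  have mc : ∀ i, c ∈ (W i).verts := fun i => by rw [hW]; simp
  have mv : ∀ i, v i ∈ (W i).verts := fun i => by rw [hW]; simp
  have mv' : ∀ i, v (i + 1) ∈ (W i).verts := fun i => by rw [hW]; simp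
  have mu : ∀ i, u i ∈ (W i).verts := fun i => by rw [hW]; simp
  have edge : ∀ {i x y}, x ∈ (W i).verts → y ∈ (W i).verts → x ≠ y → s(x, y) ∈ (W i).edges :=
    fun hx hy hxy => (OddWheel.mem_edges_iff_of_one _).2 ⟨hx, hy, hxy⟩
  have hu0 := hu 0
  have bu : u 0 ∉ ({c, v 0, v (0 + 1)} : Set V) := by
    simp only [Set.mem_insert_iff, Set.mem_singleton_iff]; tauto
  have wheel : ∀ {x y}, G.Adj x y → ∃ i, x ∈ (W i).verts ∧ y ∈ (W i).verts := by
    intro x y h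
    rw [← SimpleGraph.mem_edgeSet, hG] at h
    obtain ⟨i, hi⟩ := exists_mem_of_mem_edgeSum h
    exact ⟨i, (W i).mem_verts_of_mem_edges hi⟩
  have not_adj : ∀ i, ¬ G.Adj (v i) c := by
    intro i h
    have := (((hS i).adj_iff _ (mv i) _ (mc i)).1 h).2
    exact this (Or.inl Sym2.eq_swap)
  -- The vertex `u 0` lies in no other wheel and has the neighbours `v 0`, `v 1` and `c`. The edge
  -- `v 0 v 1` is not lost, so it shows that `v 1` is no leaf.
  obtain ⟨z, hz, h0, h1⟩ := Q.exists_common_neighbor (w := c)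
    ((hS 0).adj (edge (mu 0) (mv 0) hu0.1) bu) ((hS 0).adj (edge (mu 0) (mv' 0) hu0.2.1) bu) hne
    (fun x hx => by
      have := (hS 0).mem_verts _ (mu 0) bu x hx
      rw [hW] at this
      rcases this with rfl | rfl | rfl | rfl
      · simp
      · simp
      · simp
      · exact absurd hx (G.loopless.irrefl _))
    (((hS 0).adj_iff _ (mv' 0) _ (mv 0)).2 ⟨edge (mv' 0) (mv 0) hne.symm, by
      have := hvc 0
      have := hvc (0 + 1)
      simp only [Set.mem_insert_iff, Set.mem_singleton_iff, Sym2.eq_iff]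
      tauto⟩) hu0.1.symm
  have hzc : z ≠ c := by rintro rfl; exact not_adj _ h0
  have hz0 : z ≠ v 0 := fun h => G.loopless.irrefl _ (h ▸ h0)
  have hz1 : z ≠ v (0 + 1) := fun h => G.loopless.irrefl _ (h ▸ h1)
  have hzW : z ∉ (W 0).verts := by
    rw [hW]
    simp only [Set.mem_insert_iff, Set.mem_singleton_iff]
    tauto
  obtain ⟨j, hj0, hj⟩ := wheel h0
  obtain ⟨k, hk1, hk⟩ := wheel h1
  have hj' : (0 : ZMod (2 * p + 1)) ≠ j := by rintro rfl; exact hzW hj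
  have hk' : (0 : ZMod (2 * p + 1)) ≠ k := by rintro rfl; exact hzW hk
  rcases key hj' (mv 0) hj0 (hvc _) with ⟨-, h⟩ | ⟨ej, -⟩
  · exact hne h
  rcases key hk' (mv' 0) hk1 (hvc _) with ⟨ek, -⟩ | ⟨-, h⟩
  -- Here `j = -1` and `k = 1`. The vertex `z` other than `c` makes these wheels consecutive, so 1
  -- or 3 would vanish modulo `2 * p + 1`; for 3 this would mean `p = 1`.
  · have hjk : j ≠ k := by
      intro h
      exact n2 (by linear_combination -h - ek - ej)
    rcases key hjk hj hk hzc with ⟨h, -⟩ | ⟨h, -⟩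
    · exact n1 (by linear_combination h - ek - ej)
    · exact n3 (by linear_combination -h - ek - ej)
  · exact hne h.symm

/-- A plane multiwheel that quadrangulates a surface is the sum of three triangular wheels, hence
belongs to the Grötzsch class. -/
theorem IsPlaneMultiwheel.isGrotzschClass (hG : IsPlaneMultiwheel G) (Q : Quadrangulation G m) :
    IsGrotzschClass G := by
  obtain ⟨p, q, hp, hq, W, c, v, hV, hv, hlost, hcons, hnon, hhub, hG⟩ := hG
  have hS := isSection_plane hp hq hv hlost hcons hnon hG
  obtain ⟨n1, -⟩ := ZMod.one_two_ne_zero hp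
  have hne : ∀ i, v i ≠ v (i + 1) := fun i h => n1 (by simpa using hv h)
  have hvc : ∀ i, v i ≠ c := fun i => ((W i).ne_of_mem_edges (hq i) (hlost i).1).symm
  obtain rfl : q = fun _ => 1 := by
    funext i
    by_contra hqi
    exact (hS i).false_of_plane (by have := hq i; omega) Q (hlost i).1 (hlost i).2 (hne i) (hhub i)
  have hfourth := fun i => (W i).exists_fourth_vertex
    ((W i).mem_verts_of_mem_edges (hlost i).1).2 ((W i).mem_verts_of_mem_edges (hlost i).2).2
    ((W i).mem_verts_of_mem_edges (hlost i).1).1 (hne i) (hvc i) (hvc (i + 1))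
  choose u hu1 hu2 hu3 hW using hfourth
  obtain rfl := eq_one_of_plane_triangular hp Q hv hvc (fun i => ⟨hu1 i, hu2 i, hu3 i⟩) hW hcons
    hnon hS hG
  refine ⟨1, le_rfl, ?_⟩
  have key := @mem_two_plane_wheels V 1 (fun _ => 1) W c v hcons hnon
  have mv : ∀ i, v i ∈ (W i).verts := fun i => by rw [hW]; simp
  have mu : ∀ i, u i ∈ (W i).verts := fun i => by rw [hW]; simp
  -- Each `u i` belongs to the `i`-th wheel alone, which separates these vertices from all others.
  have huv : ∀ i j, u i ≠ v j := by
    intro i j h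
    rcases eq_or_ne i j with rfl | hij
    · exact hu1 _ h
    · rcases key hij (mu i) (h ▸ mv j) (hu3 i) with ⟨-, h⟩ | ⟨-, h⟩
      · exact hu2 _ h
      · exact hu1 _ h
  have hu : Function.Injective u := by
    intro i j h
    by_contra hij
    rcases key hij (mu i) (h ▸ mu j) (hu3 i) with ⟨-, h⟩ | ⟨-, h⟩
    · exact hu2 _ h
    · exact hu1 _ h
  let f : TriangleVertex → V := fun t => t.elim c fun a => if a.1 then u a.2 else v a.2
  have hf : Function.Injective f := by
    rintro (_ | ⟨_ | _, i⟩) (_ | ⟨_ | _, j⟩) h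
    · rfl
    · exact absurd h.symm (hvc j)
    · exact absurd h.symm (hu3 j)
    · exact absurd h (hvc i)
    · obtain rfl : i = j := hv h
      rfl
    · exact absurd h.symm (huv j i)
    · exact absurd h (hu3 i)
    · exact absurd h (huv i j)
    · obtain rfl : i = j := hu h
      rfl
  have hWf : ∀ i t, f t ∈ (W i).verts ↔ t ∈ TriangleVertex.planeSection i := by
    intro i t
    have : (W i).verts = {f none, f (some (false, i)), f (some (false, i + 1)),
      f (some (true, i))} := hW i
    rw [this]
    simp only [Set.mem_insert_iff, Set.mem_singleton_iff, hf.eq_iff, TriangleVertex.planeSection,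
      Finset.mem_insert, Finset.mem_singleton]
  have hfs : Function.Surjective f := by
    intro x
    obtain ⟨i, hi⟩ := hV x
    rw [hW] at hi
    rcases hi with rfl | rfl | rfl | rfl
    · exact ⟨none, rfl⟩
    · exact ⟨some (false, i), rfl⟩
    · exact ⟨some (false, i + 1), rfl⟩
    · exact ⟨some (true, i), rfl⟩
  refine TriangleVertex.isProjectiveWheelSum_planeSum.of_equiv (Equiv.ofBijective f ⟨hf, hfs⟩) ?_
  intro x y
  change G.Adj (f x) (f y) ↔ _
  have h : {i | s(f x, f y) ∈ (W i).edges} = (Finset.univ.filter fun i =>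
      x ≠ y ∧ x ∈ TriangleVertex.planeSection i ∧ y ∈ TriangleVertex.planeSection i :
        Finset (ZMod (2 * 1 + 1))) := by
    ext i
    simp only [OddWheel.mem_edges_iff_of_one, hWf, hf.ne_iff, Set.mem_ofPred_eq, Finset.coe_filter,
      Finset.mem_univ, true_and]
    tauto
  rw [← SimpleGraph.mem_edgeSet, hG, mem_edgeSum, h, Set.ncard_coe_finset]
  rfl

end Plane

/-- Of the hypothesis on `G` only the gluing of squares is used, not the homeomorphism type of the
surface: a multiwheel with `n` vertices has `2 n - 2` edges, so every closed surface which it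
quadrangulates has Euler characteristic one. -/
theorem theorem8 {V : Type*} (G : SimpleGraph V)
    (hG : IsPlaneMultiwheel G ∨ IsProjectiveMultiwheel G)
    (hQ : QuadrangulatesProjectivePlane G) : IsGrotzschClass G := by
  obtain ⟨m, Q, -⟩ := hQ
  exact hG.elim (fun h => h.isGrotzschClass Q) (fun h => h.isGrotzschClass Q)
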